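/- **Replacement Lemma.** Fix $\beta\in[0,\infty)$, points $b_1,\dots,b_k$ of the torus $\mathbb T=\mathbb R/\mathbb Z$ and $t\ge 0$. For $N\ge1$ let $\mathbb T_N=\mathbb Z/N\mathbb Z$, where $x\in\mathbb T_N$ corresponds to $x/N\in\mathbb T$. We say that the bond $\{x,x+1\}$ contains $u\in\mathbb T$, and that $x$ and $x+1$ are its left and right vertices, if $u\in(\frac xN,\frac{x+1}N]$. A bond is called slow if it contains some $b_i$; put $\xi^N_{x,x+1}=N^{-\beta}$ if $\{x,x+1\}$ is slow and $\xi^N_{x,x+1}=1$ otherwise. For each $N\geq 1$ let $\mu_N$ be any probability measure on $\{0,1\}^{\mathbb T_N}$, and let $\mathbb E^\beta_{\mu_N}$ be the expectation with respect to the law of the càdlàg Markov process $(\eta_s)_{s\ge0}$ on $\{0,1\}^{\mathbb T_N}$ with initial distribution $\mu_N$ and generator $N^2\mathcal L_N$, where $$\mathcal L_Nf(\eta)=\sum_{x\in\mathbb T_N}\xi^N_{x,x+1}\,[f(\eta^{x,x+1})-f(\eta)]$$ and $\eta^{x,x+1}$ is $\eta$ with the values at $x$ and $x+1$ exchanged.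 For $\varepsilon>0$ write $\ell=\lfloor\varepsilon N\rfloor$. If $\beta<1$, let $\eta^{\varepsilon N}(x)=\frac1\ell\sum_{y=x+1}^{x+\ell}\eta(y)$. If $\beta\ge1$, use the same formula when no left vertex of a slow bond lies in $\{x,\dots,x+\ell\}$, and otherwise let $\eta^{\varepsilon N}(x)=\frac1\ell\sum_{y=z-\ell+1}^{z}\eta(y)$, where $z\in\{x,\dots,x+\ell\}$ is the left vertex of a slow bond (the first one met from $x$; for $\varepsilon$ small and $N$ large there is only one). 1. Let $\beta\in[0,1)$ and $u\in\mathbb T$. If, for every $N$, $x=x_N\in\mathbb T_N$ is the left or the right vertex of the bond containing $u$, then $$\varlimsup_{\varepsilon\downarrow0}\varlimsup_{N\to\infty}\mathbb E^\beta_{\mu_N}\Big[\Big|\int_0^t\{\eta_s(x)-\eta_s^{\varepsilon N}(x)\}\,ds\Big|\Big]=0.$$ 2. Let $\beta\in[1,\infty)$. The same limit holds for every choice of sites $x=x_N\in\mathbb T_N$. Moreover, for every $H:\mathbb T\to\mathbb R$ with $\varlimsup_{N\to\infty}\frac1N\sum_{x\in\mathbb T_N}H(\frac xN)^2<\infty$,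 $$\varlimsup_{\varepsilon\downarrow0}\varlimsup_{N\to\infty}\mathbb E^\beta_{\mu_N}\Big[\Big|\int_0^t\frac1N\sum_{x\in\mathbb T_N}H(\tfrac xN)\{\eta_s(x)-\eta_s^{\varepsilon N}(x)\}\,ds\Big|\Big]=0.$$ -/

import Mathlib

open Filter Topology MeasureTheory
open scoped NNReal ENNReal

noncomputable section

namespace SlowBond

/-- Configurations `η ∈ {0,1}^{𝕋_N}`; the discrete torus `𝕋_N` with `N` sites is `ZMod N`. -/
abbrev Config (N : ℕ) : Type := ZMod N → Fin 2

/-- The occupation number `η(x)` as a real number. -/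
def occ {N : ℕ} (η : Config N) (x : ZMod N) : ℝ := ((η x : ℕ) : ℝ)

/-- The macroscopic point `x / N` of the continuous torus `𝕋 = ℝ / ℤ`. -/
def macro_point (N : ℕ) (x : ZMod N) : UnitAddCircle := (((x.val : ℝ) / N : ℝ) : UnitAddCircle)

/-- `x` is the left vertex of the bond `{x, x+1}` that contains the macroscopic point `u`,
i.e. `u` lies on the arc `(x/N, (x+1)/N]` of the torus. -/
def IsLeftVertex (N : ℕ) (u : UnitAddCircle) (x : ZMod N) : Prop :=
  ∃ v ∈ Set.Ioc ((x.val : ℝ) / N) (((x.val : ℝ) + 1) / N), (v : UnitAddCircle) = u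

/-- The bond `{x, x+1}` is slow: it contains one of the points `b_1, …, b_k`. -/
def IsSlowBond (N : ℕ) {k : ℕ} (b : Fin k → UnitAddCircle) (x : ZMod N) : Prop :=
  ∃ i, IsLeftVertex N (b i) x

open Classical in
/-- The conductance `ξ^N_{x,x+1}`: `N^{-β}` at slow bonds and `1` at all other bonds. -/
def conductance (N : ℕ) {k : ℕ} (b : Fin k → UnitAddCircle) (β : ℝ) (x : ZMod N) : ℝ :=
  if IsSlowBond N b x then (N : ℝ) ^ (-β) else 1

/-- The configuration `η^{x,x+1}`, with the occupations of `x` and `x + 1` exchanged. -/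
def exchange {N : ℕ} (η : Config N) (x : ZMod N) : Config N :=
  fun y => η (Equiv.swap x (x + 1) y)

/-- The generator
`(L_N f)(η) = ∑_{x ∈ 𝕋_N} ξ^N_{x,x+1} [f(η^{x,x+1}) - f(η)]` of the exclusion process. -/
def generator (N : ℕ) [NeZero N] {k : ℕ} (b : Fin k → UnitAddCircle) (β : ℝ)
    (f : Config N → ℝ) (η : Config N) : ℝ :=
  ∑ x : ZMod N, conductance N b β x * (f (exchange η x) - f η)

/-- The matrix of `L_N`: its `(η, ζ)` entry is `L_N 1_{ζ} (η)`. -/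
def rateMatrix (N : ℕ) [NeZero N] {k : ℕ} (b : Fin k → UnitAddCircle) (β : ℝ) :
    Matrix (Config N) (Config N) ℝ :=
  Matrix.of fun η ζ => generator N b β (Pi.single ζ 1) η

/-- The transition matrix `exp (t N² L_N)` of the exclusion process speeded up by `N²`. -/
def transition (N : ℕ) [NeZero N] {k : ℕ} (b : Fin k → UnitAddCircle) (β : ℝ) (t : ℝ) :
    Matrix (Config N) (Config N) ℝ :=
  NormedSpace.exp ((t * (N : ℝ) ^ 2) • rateMatrix N b β)

/-- The space `D(ℝ₊, {0,1}^{𝕋_N})` of càdlàg trajectories. As a subtype of a product it carries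
the σ-algebra generated by the evaluation maps. -/
abbrev PathSpace (N : ℕ) : Type :=
  {ω : ℝ≥0 → Config N //
    ∀ t, ContinuousWithinAt ω (Set.Ici t) t ∧ ∃ l, Tendsto ω (𝓝[<] t) (𝓝 l)}

/-- `P` is the law on `D(ℝ₊, {0,1}^{𝕋_N})` of the Markov process with generator `N² L_N` and
initial distribution `μ`, characterised by its finite-dimensional distributions. -/
structure IsExclusionLaw (N : ℕ) [NeZero N] {k : ℕ} (b : Fin k → UnitAddCircle) (β : ℝ)
    (μ : Measure (Config N)) (P : Measure (PathSpace N)) : Prop where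
  isProbabilityMeasure : IsProbabilityMeasure P
  fdd : ∀ (n : ℕ) (t : ℕ → ℝ≥0), t 0 = 0 → Monotone t → ∀ a : ℕ → Config N,
    P {ω | ∀ i ≤ n, ω.1 (t i) = a i} =
      μ {a 0} * ENNReal.ofReal (∏ i ∈ Finset.range n,
        transition N b β ((t (i + 1) : ℝ) - t i) (a i) (a (i + 1)))

/-- The mean occupation of the `ℓ` sites `x + 1, …, x + ℓ`. -/
def boxMean {N : ℕ} (ℓ : ℕ) (η : Config N) (x : ZMod N) : ℝ :=
  (1 / (ℓ : ℝ)) * ∑ j ∈ Finset.Icc 1 ℓ, occ η (x + (j : ZMod N))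

open Classical in
/-- The empirical density `η^ℓ(x)`. For `β < 1` it is the mean over `x + 1, …, x + ℓ`.
For `β ≥ 1` the same box is used if no left vertex of a slow bond lies in `{x, …, x + ℓ}`;
otherwise, if `z` is the left vertex of a slow bond in `{x, …, x + ℓ}`, the box is
`z - ℓ + 1, …, z`. (If there are several such `z`, the first one to the right of `x` is used;
for `ℓ = ⌊ε N⌋`, `ε` small and `N` large, `z` is unique.) -/
def empiricalDensity {N : ℕ} {k : ℕ} (b : Fin k → UnitAddCircle) (β : ℝ) (ℓ : ℕ)
    (η : Config N) (x : ZMod N) : ℝ :=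
  if β < 1 then boxMean ℓ η x
  else if ∃ j : ℕ, j ≤ ℓ ∧ IsSlowBond N b (x + (j : ZMod N)) then
    boxMean ℓ η
      (x + ((sInf {j : ℕ | IsSlowBond N b (x + (j : ZMod N))} : ℕ) : ZMod N) - (ℓ : ZMod N))
  else boxMean ℓ η x

/-- `η_s(x) - η_s^{εN}(x)` along the trajectory `ω`, where `εN` stands for `⌊ε N⌋`. -/
def discrepancy {N : ℕ} {k : ℕ} (b : Fin k → UnitAddCircle) (β ε : ℝ) (ω : PathSpace N)
    (s : ℝ) (x : ZMod N) : ℝ :=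
  occ (ω.1 s.toNNReal) x - empiricalDensity b β ⌊ε * (N : ℝ)⌋₊ (ω.1 s.toNNReal) x

end SlowBond

end

/-!
The occupation numbers are self-dual: the generator maps `∑ y, v y η(y)` to `∑ y, (L v) y η(y)`,
where `L` generates the random walk with the same conductances. Hence, for `V(η) = ∑ y, v y η(y)`,
the second moment of `∫₀ᵗ V(η_s) ds` is controlled, uniformly in the initial distribution, by the
`ℓ¹` norm of `F = ∫₀^τ exp (u N² L) v du`. If `R` is an effective resistance of `v`, that is,
`(v ⬝ᵥ g)² ≤ R * dirichletEnergy g`, differentiating `F ⬝ᵥ F` in `τ` shows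
`F ⬝ᵥ F ≤ R τ / (2 N²)`, so the `ℓ¹` norm of `F` is at most `√(R τ / (2 N))`.

For `V(η) = η(x) - η^{εN}(x)` the resistance is that of a path of `εN` bonds. If `β ≥ 1`, the box
is chosen so that no bond of the path is slow; if `β < 1`, the at most `k` slow bonds of the path
contribute `k N^β ≪ εN`. Thus `R ≤ 2 ε N`, and the bound `√(2 t √(ε t))` vanishes with `ε`.
-/

noncomputable section

namespace SlowBond

open Matrix

section MatrixExponential

variable {m n R 𝕜 : Type*} [Fintype m] [DecidableEq m] [Fintype n] [DecidableEq n]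

theorem pow_mul_of_mul_eq_mul [Semiring R] {A : Matrix m m R} {B : Matrix n n R} {M : Matrix m n R}
    (h : A * M = M * B) (j : ℕ) : A ^ j * M = M * B ^ j := by
  induction j with
  | zero => rw [pow_zero, pow_zero, Matrix.one_mul, Matrix.mul_one]
  | succ j ih =>
    rw [pow_succ, Matrix.mul_assoc, h, ← Matrix.mul_assoc, ih, Matrix.mul_assoc, ← pow_succ]

variable [RCLike 𝕜]

theorem hasSum_matrix_exp (A : Matrix m m 𝕜) :
    HasSum (fun j : ℕ => (j.factorial : 𝕜)⁻¹ • A ^ j) (NormedSpace.exp A) := by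
  open scoped Matrix.Norms.Operator in
  exact NormedSpace.exp_series_hasSum_exp' A

theorem exp_mul_of_mul_eq_mul {A : Matrix m m 𝕜} {B : Matrix n n 𝕜} {M : Matrix m n 𝕜}
    (h : A * M = M * B) : NormedSpace.exp A * M = M * NormedSpace.exp B := by
  have hA := (hasSum_matrix_exp A).map (mulRightLinearMap m 𝕜 M)
    (continuous_id.matrix_mul continuous_const)
  have hB := (hasSum_matrix_exp B).map (mulLeftLinearMap n 𝕜 M)
    (continuous_const.matrix_mul continuous_id)
  refine hA.unique (hB.congr_fun fun j => ?_)
  simp only [Function.comp_apply, map_smul, mulRightLinearMap_apply, mulLeftLinearMap_apply,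
    pow_mul_of_mul_eq_mul h]

theorem exp_apply_nonneg {A : Matrix m m ℝ} (hA : ∀ i j, 0 ≤ A i j) (i j : m) :
    0 ≤ NormedSpace.exp A i j :=
  (Pi.hasSum.1 (Pi.hasSum.1 (hasSum_matrix_exp A) i) j).nonneg fun p =>
    mul_nonneg (by positivity) (pow_apply_nonneg hA p i j)

theorem exp_add_smul_one (A : Matrix m m ℝ) (c : ℝ) :
    NormedSpace.exp (A + c • (1 : Matrix m m ℝ)) = Real.exp c • NormedSpace.exp A := by
  rw [exp_add_of_commute _ _ ((Commute.one_right A).smul_right c), smul_one_eq_diagonal,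
    exp_diagonal, Pi.exp_def, Real.exp_eq_exp_ℝ, ← smul_one_eq_diagonal,
    Matrix.mul_smul, Matrix.mul_one]

theorem exp_apply_nonneg_of_off_diagonal {A : Matrix m m ℝ} (hA : ∀ i j, i ≠ j → 0 ≤ A i j)
    (i j : m) : 0 ≤ NormedSpace.exp A i j := by
  obtain ⟨c, hc⟩ : ∃ c : ℝ, ∀ l, -A l l ≤ c := by
    obtain ⟨c, hc⟩ := (Set.finite_range fun l => -A l l).bddAbove
    exact ⟨c, fun l => hc ⟨l, rfl⟩⟩
  have hshift : ∀ i j, 0 ≤ (A + c • (1 : Matrix m m ℝ)) i j := by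
    intro i j
    rcases eq_or_ne i j with rfl | hij
    · simpa using neg_le_iff_add_nonneg'.1 (hc i)
    · simpa [one_apply_ne hij] using hA i j hij
  have hexp := exp_apply_nonneg hshift i j
  rw [exp_add_smul_one, Matrix.smul_apply, smul_eq_mul] at hexp
  exact nonneg_of_mul_nonneg_right hexp (Real.exp_pos c)

end MatrixExponential

section TimeIntegral

variable {m n : Type*} [Fintype m] [DecidableEq m] [Fintype n]

theorem hasDerivAt_exp_smul_mulVec (A : Matrix m m ℝ) (v : m → ℝ) (u : ℝ) :
    HasDerivAt (fun u : ℝ => NormedSpace.exp (u • A) *ᵥ v)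
      (A *ᵥ NormedSpace.exp (u • A) *ᵥ v) u := by
  open scoped Matrix.Norms.Operator in
  rw [mulVec_mulVec]
  exact ((mulVecBilin ℝ ℝ).flip v).toContinuousLinearMap.hasFDerivAt.comp_hasDerivAt u
    (hasDerivAt_exp_smul_const' (𝕂 := ℝ) A u)

theorem continuous_exp_smul_mulVec (A : Matrix m m ℝ) (v : m → ℝ) :
    Continuous fun u : ℝ => NormedSpace.exp (u • A) *ᵥ v :=
  continuous_iff_continuousAt.2 fun u => (hasDerivAt_exp_smul_mulVec A v u).continuousAt

/-- The time integral `∫₀^τ exp (u A) v du` along the semigroup generated by `A`, started at `v`. -/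
def expIntegral (A : Matrix m m ℝ) (v : m → ℝ) (τ : ℝ) : m → ℝ :=
  ∫ u in 0..τ, NormedSpace.exp (u • A) *ᵥ v

theorem hasDerivAt_expIntegral (A : Matrix m m ℝ) (v : m → ℝ) (τ : ℝ) :
    HasDerivAt (expIntegral A v) (NormedSpace.exp (τ • A) *ᵥ v) τ :=
  ((continuous_exp_smul_mulVec A v).integral_hasStrictDerivAt 0 τ).hasDerivAt

theorem mulVec_expIntegral (M : Matrix n m ℝ) (A : Matrix m m ℝ) (v : m → ℝ) (τ : ℝ) :
    M *ᵥ expIntegral A v τ = ∫ u in 0..τ, M *ᵥ NormedSpace.exp (u • A) *ᵥ v :=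
  (M.mulVecLin.toContinuousLinearMap.intervalIntegral_comp_comm
    ((continuous_exp_smul_mulVec A v).intervalIntegrable 0 τ)).symm

theorem dotProduct_expIntegral (w : m → ℝ) (A : Matrix m m ℝ) (v : m → ℝ) (τ : ℝ) :
    w ⬝ᵥ expIntegral A v τ = ∫ u in 0..τ, w ⬝ᵥ NormedSpace.exp (u • A) *ᵥ v :=
  ((dotProductBilin ℝ ℝ w).toContinuousLinearMap.intervalIntegral_comp_comm
    ((continuous_exp_smul_mulVec A v).intervalIntegrable 0 τ)).symm

theorem exp_smul_mulVec_eq (A : Matrix m m ℝ) (v : m → ℝ) (τ : ℝ) :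
    NormedSpace.exp (τ • A) *ᵥ v = v + A *ᵥ expIntegral A v τ := by
  have hcont : Continuous fun u : ℝ => A *ᵥ NormedSpace.exp (u • A) *ᵥ v :=
    continuous_const.matrix_mulVec (continuous_exp_smul_mulVec A v)
  rw [mulVec_expIntegral, intervalIntegral.integral_eq_sub_of_hasDerivAt
    (fun u _ => hasDerivAt_exp_smul_mulVec A v u) (hcont.intervalIntegrable 0 τ), zero_smul,
    NormedSpace.exp_zero, one_mulVec, add_sub_cancel]

theorem expIntegral_mulVec_of_mul_eq_mul [DecidableEq n] {A : Matrix m m ℝ} {B : Matrix n n ℝ}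
    {M : Matrix m n ℝ} (h : A * M = M * B) (v : n → ℝ) (τ : ℝ) :
    expIntegral A (M *ᵥ v) τ = M *ᵥ expIntegral B v τ := by
  rw [mulVec_expIntegral, expIntegral]
  congr 1
  ext1 u
  have hu : (u • A) * M = M * (u • B) := by rw [Matrix.smul_mul, h, Matrix.mul_smul]
  rw [mulVec_mulVec, exp_mul_of_mul_eq_mul hu, ← mulVec_mulVec]

theorem hasDerivAt_expIntegral_dotProduct_self (A : Matrix m m ℝ) (v : m → ℝ) (τ : ℝ) :
    HasDerivAt (fun τ => expIntegral A v τ ⬝ᵥ expIntegral A v τ)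
      (2 * (v ⬝ᵥ expIntegral A v τ + expIntegral A v τ ⬝ᵥ A *ᵥ expIntegral A v τ)) τ := by
  have hcoord := hasDerivAt_pi.1 (hasDerivAt_expIntegral A v τ)
  refine (HasDerivAt.fun_sum fun i _ => (hcoord i).mul (hcoord i)).congr_deriv ?_
  rw [exp_smul_mulVec_eq, Finset.sum_add_distrib, dotProduct_comm v, ← dotProduct_add, two_mul,
    dotProduct_comm]
  simp only [dotProduct, mul_comm]

/-- If `R` bounds the effective resistance of `v` for the quadratic form `-g ⬝ᵥ A *ᵥ g`, the gain
`2 v ⬝ᵥ F` of `F ⬝ᵥ F` is compensated by its dissipation up to the constant `R / 2`. -/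
theorem expIntegral_dotProduct_self_le {A : Matrix m m ℝ} {v : m → ℝ} {R : ℝ} (hR : 0 < R)
    (hv : ∀ g, (v ⬝ᵥ g) ^ 2 ≤ R * -(g ⬝ᵥ A *ᵥ g)) {τ : ℝ} (hτ : 0 ≤ τ) :
    expIntegral A v τ ⬝ᵥ expIntegral A v τ ≤ R / 2 * τ := by
  have hderiv := hasDerivAt_expIntegral_dotProduct_self A v
  have hderiv_le : ∀ σ, 2 * (v ⬝ᵥ expIntegral A v σ +
      expIntegral A v σ ⬝ᵥ A *ᵥ expIntegral A v σ) ≤ R / 2 := by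
    intro σ
    nlinarith [hv (expIntegral A v σ), sq_nonneg (R - 2 * (v ⬝ᵥ expIntegral A v σ))]
  have hmono := image_sub_le_mul_sub_of_deriv_le (fun σ => (hderiv σ).differentiableAt)
    (fun σ => (hderiv σ).deriv.trans_le (hderiv_le σ)) hτ
  simpa [expIntegral] using hmono

theorem sum_abs_expIntegral_le {A : Matrix m m ℝ} {v : m → ℝ} {R : ℝ} (hR : 0 < R)
    (hv : ∀ g, (v ⬝ᵥ g) ^ 2 ≤ R * -(g ⬝ᵥ A *ᵥ g)) {τ : ℝ} (hτ : 0 ≤ τ) :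
    ∑ i, |expIntegral A v τ i| ≤ √(Fintype.card m * (R / 2 * τ)) := by
  refine Real.le_sqrt_of_sq_le (sq_sum_le_card_mul_sum_sq.trans ?_)
  have henergy := expIntegral_dotProduct_self_le hR hv hτ
  simp only [dotProduct, ← sq] at henergy
  simp only [sq_abs, Finset.card_univ]
  gcongr

end TimeIntegral

section SecondMoment

open Function (uncurry)

theorem sq_intervalIntegral_eq {f : ℝ → ℝ} {a b : ℝ} (hf : IntervalIntegrable f volume a b) :
    (∫ s in a..b, f s) ^ 2 = 2 * ∫ s in a..b, f s * ∫ r in s..b, f r := by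
  have hac := hf.absolutelyContinuousOnInterval_intervalIntegral Set.right_mem_uIcc
  have hparts := hac.integral_deriv_mul_eq_sub hac
  have hderiv : ∀ᵐ s, s ∈ Set.uIoc a b →
      deriv (fun s => ∫ r in b..s, f r) s * (∫ r in b..s, f r) +
        (∫ r in b..s, f r) * deriv (fun s => ∫ r in b..s, f r) s =
      -2 * (f s * ∫ r in s..b, f r) := by
    filter_upwards [hf.ae_hasDerivAt_integral] with s hs hsab
    rw [(hs (Set.uIoc_subset_uIcc hsab) b Set.right_mem_uIcc).deriv,
      intervalIntegral.integral_symm s b]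
    ring
  rw [intervalIntegral.integral_congr_ae hderiv, intervalIntegral.integral_const_mul,
    intervalIntegral.integral_same, intervalIntegral.integral_symm a b] at hparts
  linarith

variable {Ω : Type*} [MeasurableSpace Ω] {P : Measure Ω} {Z : ℝ → Ω → ℝ} {C : ℝ}

theorem intervalIntegrable_of_abs_le (hZ : Measurable (uncurry Z)) (hC : ∀ s ω, |Z s ω| ≤ C)
    (ω : Ω) (a b : ℝ) : IntervalIntegrable (fun s => Z s ω) volume a b :=
  (intervalIntegrable_const (c := C)).mono_fun'
    (hZ.comp measurable_prodMk_right).aestronglyMeasurable (.of_forall fun s => hC s ω)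

theorem measurable_intervalIntegral (hZ : Measurable (uncurry Z)) (a b : ℝ) :
    Measurable fun ω => ∫ s in a..b, Z s ω := by
  have hmeas : ∀ S : Set ℝ, Measurable fun ω => ∫ s in S, Z s ω := fun S =>
    (hZ.comp measurable_swap).stronglyMeasurable.integral_prod_right'.measurable
  exact (hmeas _).sub (hmeas _)

theorem measurable_uncurry_intervalIntegral_left (hZ : Measurable (uncurry Z))
    (hC : ∀ s ω, |Z s ω| ≤ C) (b : ℝ) :
    Measurable (uncurry fun a ω => ∫ s in a..b, Z s ω) := by
  refine measurable_uncurry_of_continuous_of_measurable (fun ω => ?_)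
    fun a => measurable_intervalIntegral hZ a b
  simp only [intervalIntegral.integral_symm b]
  exact (intervalIntegral.continuous_primitive (intervalIntegrable_of_abs_le hZ hC ω) b).neg

theorem lintegral_abs_le_sqrt_integral_sq [IsProbabilityMeasure P] {X : Ω → ℝ} (hX : MemLp X 2 P) :
    ∫⁻ ω, ENNReal.ofReal |X ω| ∂P ≤ ENNReal.ofReal √(∫ ω, X ω ^ 2 ∂P) := by
  have habs : MemLp (fun ω => |X ω|) 2 P := hX.abs
  have hvar := ProbabilityTheory.variance_nonneg (fun ω => |X ω|) P
  rw [ProbabilityTheory.variance_eq_sub habs, sub_nonneg] at hvar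
  rw [← ofReal_integral_eq_lintegral_ofReal (habs.integrable one_le_two)
    (.of_forall fun ω => abs_nonneg _)]
  refine ENNReal.ofReal_le_ofReal (Real.le_sqrt_of_sq_le (hvar.trans_eq ?_))
  simp only [Pi.pow_apply, sq_abs]

theorem lintegral_abs_intervalIntegral_sum_le {ι : Type*} [Fintype ι] {Z : ι → ℝ → Ω → ℝ}
    (hZ : ∀ x, Measurable (uncurry (Z x))) (hC : ∀ x s ω, |Z x s ω| ≤ C) (w : ι → ℝ) {a b : ℝ}
    {B : ℝ≥0∞} (hB : ∀ x, ∫⁻ ω, ENNReal.ofReal |∫ s in a..b, Z x s ω| ∂P ≤ B) :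
    ∫⁻ ω, ENNReal.ofReal |∫ s in a..b, ∑ x, w x * Z x s ω| ∂P ≤
      ENNReal.ofReal (∑ x, |w x|) * B := by
  have hmeas : ∀ x, Measurable fun ω => ENNReal.ofReal |∫ s in a..b, Z x s ω| := fun x =>
    (measurable_intervalIntegral (hZ x) a b).abs.ennreal_ofReal
  have htriangle : ∀ ω, ENNReal.ofReal |∫ s in a..b, ∑ x, w x * Z x s ω| ≤
      ∑ x, ENNReal.ofReal |w x| * ENNReal.ofReal |∫ s in a..b, Z x s ω| := by
    intro ω
    simp only [← ENNReal.ofReal_mul (abs_nonneg _)]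
    rw [← ENNReal.ofReal_sum_of_nonneg fun x _ => by positivity,
      intervalIntegral.integral_finsetSum fun x _ =>
        (intervalIntegrable_of_abs_le (hZ x) (hC x) ω a b).const_mul _]
    simp only [intervalIntegral.integral_const_mul, ← abs_mul]
    exact ENNReal.ofReal_le_ofReal (Finset.abs_sum_le_sum_abs _ _)
  calc ∫⁻ ω, ENNReal.ofReal |∫ s in a..b, ∑ x, w x * Z x s ω| ∂P
      ≤ ∫⁻ ω, ∑ x, ENNReal.ofReal |w x| * ENNReal.ofReal |∫ s in a..b, Z x s ω| ∂P :=
        lintegral_mono htriangle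
    _ = ∑ x, ENNReal.ofReal |w x| * ∫⁻ ω, ENNReal.ofReal |∫ s in a..b, Z x s ω| ∂P := by
        rw [lintegral_finsetSum _ fun x _ => (hmeas x).const_mul _]
        exact Finset.sum_congr rfl fun x _ => lintegral_const_mul _ (hmeas x)
    _ ≤ ∑ x, ENNReal.ofReal |w x| * B := by
        gcongr
        exact hB _
    _ = ENNReal.ofReal (∑ x, |w x|) * B := by
        rw [← Finset.sum_mul, ENNReal.ofReal_sum_of_nonneg fun x _ => abs_nonneg _]

variable [IsFiniteMeasure P]

theorem integrable_mul_intervalIntegral (hZ : Measurable (uncurry Z)) (hC : ∀ s ω, |Z s ω| ≤ C)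
    (a b : ℝ) : Integrable (uncurry fun s ω => Z s ω * ∫ r in s..b, Z r ω)
      ((volume.restrict (Set.uIoc a b)).prod P) := by
  have : IsFiniteMeasure (volume.restrict (Set.uIoc a b)) := Real.isFiniteMeasure_restrict_Ioc _ _
  have hprod := hZ.mul (measurable_uncurry_intervalIntegral_left hZ hC b)
  refine Integrable.of_bound hprod.aestronglyMeasurable (C * (C * |b - a|)) ?_
  have hmem : ∀ᵐ p ∂(volume.restrict (Set.uIoc a b)).prod P, p.1 ∈ Set.uIoc a b :=
    Measure.quasiMeasurePreserving_fst.ae (ae_restrict_mem measurableSet_uIoc)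
  filter_upwards [hmem] with ⟨s, ω⟩ hs
  have hC0 : 0 ≤ C := (abs_nonneg _).trans (hC s ω)
  rw [Real.norm_eq_abs, Function.uncurry_apply_pair, abs_mul]
  gcongr
  · exact hC s ω
  · refine (intervalIntegral.norm_integral_le_of_norm_le_const (f := fun r => Z r ω) fun r _ =>
      hC r ω).trans ?_
    gcongr C * ?_
    exact Set.abs_sub_right_of_mem_uIcc (Set.uIoc_subset_uIcc hs)

theorem integral_sq_intervalIntegral_eq (hZ : Measurable (uncurry Z)) (hC : ∀ s ω, |Z s ω| ≤ C)
    (a b : ℝ) : ∫ ω, (∫ s in a..b, Z s ω) ^ 2 ∂P =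
      2 * ∫ s in a..b, ∫ ω, Z s ω * (∫ r in s..b, Z r ω) ∂P := by
  rw [intervalIntegral_integral_swap (integrable_mul_intervalIntegral hZ hC a b),
    ← integral_const_mul]
  exact integral_congr_ae (.of_forall fun ω =>
    sq_intervalIntegral_eq (intervalIntegrable_of_abs_le hZ hC ω a b))

theorem integral_mul_intervalIntegral_eq (hZ : Measurable (uncurry Z))
    (hC : ∀ s ω, |Z s ω| ≤ C) (a b : ℝ) :
    ∫ ω, Z a ω * (∫ r in a..b, Z r ω) ∂P = ∫ r in a..b, ∫ ω, Z a ω * Z r ω ∂P := by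
  have : IsFiniteMeasure (volume.restrict (Set.uIoc a b)) := Real.isFiniteMeasure_restrict_Ioc _ _
  have hmeas : Measurable (uncurry fun r ω => Z a ω * Z r ω) :=
    (hZ.comp (measurable_const.prodMk measurable_snd)).mul hZ
  have hint : Integrable (uncurry fun r ω => Z a ω * Z r ω)
      ((volume.restrict (Set.uIoc a b)).prod P) := by
    refine Integrable.of_bound hmeas.aestronglyMeasurable (C * C) (.of_forall fun ⟨r, ω⟩ => ?_)
    rw [Real.norm_eq_abs, Function.uncurry_apply_pair, abs_mul]
    exact mul_le_mul (hC a ω) (hC r ω) (abs_nonneg _) ((abs_nonneg _).trans (hC a ω))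
  rw [intervalIntegral_integral_swap hint]
  simp only [intervalIntegral.integral_const_mul]

theorem integral_sq_intervalIntegral_le (hZ : Measurable (uncurry Z)) (hC : ∀ s ω, |Z s ω| ≤ C)
    {a b K : ℝ} (hab : a ≤ b)
    (hK : ∀ s ∈ Set.Icc a b, ∫ r in s..b, ∫ ω, Z s ω * Z r ω ∂P ≤ K) :
    ∫ ω, (∫ s in a..b, Z s ω) ^ 2 ∂P ≤ 2 * (K * (b - a)) := by
  have hint := (integrable_mul_intervalIntegral (P := P) hZ hC a b).integral_prod_left
  rw [Set.uIoc_of_le hab] at hint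
  rw [integral_sq_intervalIntegral_eq hZ hC]
  have hle := intervalIntegral.integral_mono_on hab
    ((intervalIntegrable_iff_integrableOn_Ioc_of_le hab).2 hint) intervalIntegrable_const
    fun s hs => (integral_mul_intervalIntegral_eq hZ hC s b).trans_le (hK s hs)
  rw [intervalIntegral.integral_const, smul_eq_mul, mul_comm (b - a)] at hle
  exact mul_le_mul_of_nonneg_left hle zero_le_two

end SecondMoment

section Duality

variable {ι α α' : Type*} [Fintype ι]

/-- The matrix of the generator `f ↦ ∑ x, c x (f ∘ σ x - f)` of the Markov chain which applies the
map `σ x` at rate `c x`. -/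
def jumpMatrix [DecidableEq α] (c : ι → ℝ) (σ : ι → α → α) : Matrix α α ℝ :=
  Matrix.of fun i j => ∑ x, c x * ((Pi.single j 1 : α → ℝ) (σ x i) - (Pi.single j 1 : α → ℝ) i)

theorem jumpMatrix_mul_apply [Fintype α] [DecidableEq α] (c : ι → ℝ) (σ : ι → α → α)
    (M : Matrix α α' ℝ) (i : α) (j : α') :
    (jumpMatrix c σ * M) i j = ∑ x, c x * (M (σ x i) j - M i j) := by
  simp only [Matrix.mul_apply, jumpMatrix, of_apply, Finset.sum_mul]
  rw [Finset.sum_comm]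
  simp only [mul_assoc, sub_mul, ← Finset.mul_sum, Finset.sum_sub_distrib, Pi.single_apply,
    ite_mul, one_mul, zero_mul, Finset.sum_ite_eq, Finset.mem_univ, if_true]

theorem mul_jumpMatrix_apply [Fintype α] [DecidableEq α] (c : ι → ℝ) (τ : ι → Equiv.Perm α)
    (M : Matrix α' α ℝ) (i : α') (j : α) :
    (M * jumpMatrix c fun x => τ x) i j = ∑ x, c x * (M i ((τ x).symm j) - M i j) := by
  simp only [Matrix.mul_apply, jumpMatrix, of_apply, Finset.mul_sum]
  rw [Finset.sum_comm]
  simp only [mul_comm (M i _), mul_assoc, sub_mul, ← Finset.mul_sum, Finset.sum_sub_distrib,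
    Pi.single_apply, ← Equiv.eq_symm_apply, ite_mul, one_mul, zero_mul, Finset.sum_ite_eq',
    Finset.mem_univ, if_true]

theorem jumpMatrix_apply_nonneg_of_ne [DecidableEq α] {c : ι → ℝ} (hc : ∀ x, 0 ≤ c x)
    (σ : ι → α → α) {i j : α} (hij : i ≠ j) : 0 ≤ jumpMatrix c σ i j := by
  refine Finset.sum_nonneg fun x _ => mul_nonneg (hc x) ?_
  rw [Pi.single_eq_of_ne hij, sub_zero, Pi.single_apply]
  split_ifs <;> norm_num

theorem sum_mul_swap_sub [Fintype α] [DecidableEq α] (f : α → ℝ) (a b : α) :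
    ∑ i, f i * (f (Equiv.swap a b i) - f i) = -(f b - f a) ^ 2 := by
  rcases eq_or_ne a b with rfl | hab
  · simp
  rw [Fintype.sum_eq_add a b hab fun i hi => by
      rw [Equiv.swap_apply_of_ne_of_ne hi.1 hi.2, sub_self, mul_zero],
    Equiv.swap_apply_left, Equiv.swap_apply_right]
  ring

variable {N : ℕ} [NeZero N]

/-- The generator of the random walk on the discrete torus which crosses the bond `{x, x + 1}` in
either direction at rate `c x`. -/
def walkMatrix (c : ZMod N → ℝ) : Matrix (ZMod N) (ZMod N) ℝ :=
  jumpMatrix c fun x => Equiv.swap x (x + 1)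

/-- The energy of `g` in the network on the discrete torus where the bond `{x, x + 1}` has
conductance `c x`. -/
def dirichletEnergy (c g : ZMod N → ℝ) : ℝ := ∑ x, c x * (g (x + 1) - g x) ^ 2

theorem dotProduct_walkMatrix_mulVec (c g : ZMod N → ℝ) :
    g ⬝ᵥ walkMatrix c *ᵥ g = -dirichletEnergy c g := by
  have hmulVec : ∀ y, (walkMatrix c *ᵥ g) y =
      ∑ x, c x * (g (Equiv.swap x (x + 1) y) - g y) := fun y =>
    jumpMatrix_mul_apply c _ (replicateCol Unit g) y ()
  simp only [dotProduct, hmulVec, Finset.mul_sum, mul_left_comm (g _)]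
  rw [Finset.sum_comm]
  simp only [← Finset.mul_sum, sum_mul_swap_sub, dirichletEnergy, mul_neg, Finset.sum_neg_distrib]

/-- The matrix of occupation numbers, which sends `v` to the linear functional `∑ y, v y η(y)` of
the configuration `η`. -/
def occMatrix (N : ℕ) : Matrix (Config N) (ZMod N) ℝ := Matrix.of occ

variable {k : ℕ} (b : Fin k → UnitAddCircle) (β : ℝ)

theorem rateMatrix_mul_occMatrix : rateMatrix N b β * occMatrix N =
    occMatrix N * walkMatrix (conductance N b β) := by
  ext η y
  refine (jumpMatrix_mul_apply _ (fun x η => exchange η x) _ η y).trans ?_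
  simp only [walkMatrix, mul_jumpMatrix_apply, Equiv.symm_swap]
  rfl

theorem conductance_pos (x : ZMod N) : 0 < conductance N b β x := by
  have hN : (0 : ℝ) < N := Nat.cast_pos.2 (NeZero.pos N)
  unfold conductance
  split_ifs <;> positivity

theorem transition_apply_nonneg {t : ℝ} (ht : 0 ≤ t) (η ζ : Config N) :
    0 ≤ transition N b β t η ζ :=
  exp_apply_nonneg_of_off_diagonal (fun _ _ hne => mul_nonneg (by positivity)
    (jumpMatrix_apply_nonneg_of_ne (fun x => (conductance_pos b β x).le)
      (fun x η => exchange η x) hne)) η ζ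

end Duality

section MarkovProperty

variable {N k : ℕ} {b : Fin k → UnitAddCircle} {β : ℝ}

theorem measurable_eval (s : ℝ≥0) : Measurable fun ω : PathSpace N => ω.1 s :=
  (measurable_pi_apply s).comp measurable_subtype_coe

theorem integral_comp_eq_sum {Ω α : Type*} [MeasurableSpace Ω] [Fintype α] [MeasurableSpace α]
    [MeasurableSingletonClass α] {P : Measure Ω} [IsFiniteMeasure P] {X : Ω → α}
    (hX : Measurable X) (φ : α → ℝ) :
    ∫ ω, φ (X ω) ∂P = ∑ a, P.real {ω | X ω = a} * φ a := by
  have hφ : AEStronglyMeasurable φ (P.map X) := (measurable_of_finite φ).aestronglyMeasurable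
  rw [← integral_map hX.aemeasurable hφ, integral_fintype .of_finite]
  simp only [map_measureReal_apply hX (measurableSet_singleton _), smul_eq_mul]
  rfl

variable [NeZero N] {μ : Measure (Config N)} {P : Measure (PathSpace N)} {s r : ℝ≥0}

theorem IsExclusionLaw.measure_eval_zero_and (hP : IsExclusionLaw N b β μ P) (hsr : s ≤ r)
    (d a c : Config N) :
    P {ω | ω.1 0 = d ∧ ω.1 s = a ∧ ω.1 r = c} =
      μ {d} * ENNReal.ofReal (transition N b β s d a * transition N b β (r - s) a c) := by
  let times : ℕ → ℝ≥0 := fun | 0 => 0 | 1 => s | _ + 2 => r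
  let states : ℕ → Config N := fun | 0 => d | 1 => a | _ + 2 => c
  have hmono : Monotone times :=
    monotone_nat_of_le_succ fun | 0 => zero_le | 1 => hsr | _ + 2 => le_rfl
  have hfdd := hP.fdd 2 times rfl hmono states
  rw [Finset.prod_range_succ, Finset.prod_range_one] at hfdd
  simp only [times, states, NNReal.coe_zero, sub_zero] at hfdd
  rw [← hfdd]
  congr 1
  ext ω
  exact ⟨fun ⟨h_zero, hs, hr⟩ => fun | 0, _ => h_zero | 1, _ => hs | _ + 2, _ => hr,
    fun h => ⟨h 0 zero_le_two, h 1 one_le_two, h 2 le_rfl⟩⟩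

theorem IsExclusionLaw.measure_eval_and (hP : IsExclusionLaw N b β μ P) (hsr : s ≤ r)
    (a c : Config N) : P {ω | ω.1 s = a ∧ ω.1 r = c} =
      (∑ d, μ {d} * ENNReal.ofReal (transition N b β s d a)) *
        ENNReal.ofReal (transition N b β (r - s) a c) := by
  have hsum := sum_measure_preimage_singleton
    (μ := P.restrict {ω | ω.1 s = a ∧ ω.1 r = c}) (f := fun ω => ω.1 0) Finset.univ
    fun d _ => measurable_eval 0 (measurableSet_singleton d)
  simp only [Finset.coe_univ, Set.preimage_univ, Measure.restrict_apply_univ,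
    Measure.restrict_apply (measurable_eval 0 (measurableSet_singleton _))] at hsum
  rw [← hsum, Finset.sum_mul]
  refine Finset.sum_congr rfl fun d _ => (hP.measure_eval_zero_and hsr d a c).trans ?_
  rw [ENNReal.ofReal_mul (transition_apply_nonneg b β s.coe_nonneg d a), mul_assoc]

theorem IsExclusionLaw.measureReal_eval_and (hP : IsExclusionLaw N b β μ P) (hsr : s ≤ r)
    (a c : Config N) : P.real {ω | ω.1 s = a ∧ ω.1 r = c} =
      P.real {ω | ω.1 s = a} * transition N b β (r - s) a c := by
  have hmarginal := hP.measure_eval_and le_rfl a a (s := s)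
  simp only [and_self, sub_self, transition, zero_mul, zero_smul, NormedSpace.exp_zero,
    Matrix.one_apply_eq, ENNReal.ofReal_one, mul_one] at hmarginal
  have hsr' : (0 : ℝ) ≤ r - s := sub_nonneg.2 (NNReal.coe_le_coe.2 hsr)
  rw [measureReal_def, hP.measure_eval_and hsr, ENNReal.toReal_mul,
    ENNReal.toReal_ofReal (transition_apply_nonneg b β hsr' a c), measureReal_def, hmarginal]
  rfl

theorem IsExclusionLaw.integral_mul_eval (hP : IsExclusionLaw N b β μ P) (hsr : s ≤ r)
    (F G : Config N → ℝ) : ∫ ω, F (ω.1 s) * G (ω.1 r) ∂P =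
      (fun a => P.real {ω | ω.1 s = a} * F a) ⬝ᵥ transition N b β (r - s) *ᵥ G := by
  have := hP.isProbabilityMeasure
  have hsum := integral_comp_eq_sum (P := P) ((measurable_eval s).prodMk (measurable_eval r))
    fun p : Config N × Config N => F p.1 * G p.2
  simp only [Fintype.sum_prod_type, Prod.mk.injEq, hP.measureReal_eval_and hsr] at hsum
  rw [hsum]
  simp only [dotProduct, mulVec, Finset.mul_sum]
  exact Finset.sum_congr rfl fun a _ => Finset.sum_congr rfl fun c _ => by ring

theorem IsExclusionLaw.intervalIntegral_integral_mul_eval (hP : IsExclusionLaw N b β μ P)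
    {s t : ℝ} (hs : 0 ≤ s) (hst : s ≤ t) (F G : Config N → ℝ) :
    ∫ r in s..t, ∫ ω, F (ω.1 s.toNNReal) * G (ω.1 r.toNNReal) ∂P =
      ∫ ω, F (ω.1 s.toNNReal) *
        expIntegral ((N : ℝ) ^ 2 • rateMatrix N b β) G (t - s) (ω.1 s.toNNReal) ∂P := by
  have := hP.isProbabilityMeasure
  have hmarkov : ∀ r ∈ Set.uIcc s t, ∫ ω, F (ω.1 s.toNNReal) * G (ω.1 r.toNNReal) ∂P =
      (fun a => P.real {ω | ω.1 s.toNNReal = a} * F a) ⬝ᵥ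
        NormedSpace.exp ((r - s) • (N : ℝ) ^ 2 • rateMatrix N b β) *ᵥ G := by
    intro r hr
    rw [Set.uIcc_of_le hst] at hr
    rw [hP.integral_mul_eval (Real.toNNReal_le_toNNReal hr.1), Real.coe_toNNReal s hs,
      Real.coe_toNNReal r (hs.trans hr.1), transition, smul_smul]
  rw [intervalIntegral.integral_congr hmarkov, intervalIntegral.integral_comp_sub_right
      (fun u => _ ⬝ᵥ NormedSpace.exp (u • (N : ℝ) ^ 2 • rateMatrix N b β) *ᵥ G), sub_self,
    ← dotProduct_expIntegral, integral_comp_eq_sum (measurable_eval s.toNNReal) fun a =>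
      F a * expIntegral ((N : ℝ) ^ 2 • rateMatrix N b β) G (t - s) a]
  simp only [dotProduct, mul_assoc]

end MarkovProperty

section RightContinuity

open Function (uncurry)

theorem tendsto_floor_mul_add_one_div (s : ℝ≥0) :
    Tendsto (fun n : ℕ => ((⌊s * (n + 1)⌋₊ : ℝ≥0) + 1) / (n + 1)) atTop (𝓝[≥] s) := by
  have hge : ∀ n : ℕ, s ≤ ((⌊s * (n + 1)⌋₊ : ℝ≥0) + 1) / (n + 1) := fun n => by
    rw [le_div_iff₀ (by positivity)]
    exact (Nat.lt_floor_add_one _).le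
  have hle : ∀ n : ℕ, ((⌊s * (n + 1)⌋₊ : ℝ≥0) + 1) / (n + 1) ≤
      s + 1 / ((n : ℝ≥0) + 1) := fun n => by
    rw [add_div]
    gcongr
    exact div_le_of_le_mul₀ (by positivity) (by positivity) (Nat.floor_le (by positivity))
  have hlim : Tendsto (fun n : ℕ => s + 1 / ((n : ℝ≥0) + 1)) atTop (𝓝 s) := by
    simpa using (tendsto_one_div_add_atTop_nhds_zero_nat (𝕜 := ℝ≥0)).const_add s
  exact tendsto_nhdsWithin_iff.2
    ⟨tendsto_of_tendsto_of_tendsto_of_le_of_le tendsto_const_nhds hlim hge hle, .of_forall hge⟩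

theorem measurable_uncurry_of_continuousWithinAt_Ici {Ω E : Type*} [MeasurableSpace Ω]
    [TopologicalSpace E] [TopologicalSpace.PseudoMetrizableSpace E] [MeasurableSpace E]
    [BorelSpace E] {X : ℝ≥0 → Ω → E} (hX : ∀ s, Measurable (X s))
    (hcont : ∀ ω s, ContinuousWithinAt (fun s => X s ω) (Set.Ici s) s) :
    Measurable (uncurry X) := by
  have hdiscrete : ∀ (φ : ℕ → ℝ≥0) (f : ℝ≥0 → ℕ), Measurable f →
      Measurable fun p : ℝ≥0 × Ω => X (φ (f p.1)) p.2 := fun φ f hf =>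
    have hcountable : Measurable fun q : ℕ × Ω => X (φ q.1) q.2 :=
      measurable_from_prod_countable_right fun m => hX (φ m)
    hcountable.comp (hf.prodMap measurable_id)
  exact measurable_of_tendsto_metrizable
    (fun n : ℕ => hdiscrete (fun m => (m + 1) / (n + 1)) (fun s => ⌊s * (n + 1)⌋₊)
      (Nat.measurable_floor.comp (measurable_mul_const _)))
    (tendsto_pi_nhds.2 fun p =>
      (hcont p.2 p.1).tendsto.comp (tendsto_floor_mul_add_one_div p.1))

theorem measurable_uncurry_comp_eval {N : ℕ} [NeZero N] (F : Config N → ℝ) :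
    Measurable (uncurry fun (s : ℝ) (ω : PathSpace N) => F (ω.1 s.toNNReal)) := by
  have hF : Continuous F := continuous_of_discreteTopology
  have hpath : Measurable (uncurry fun (s : ℝ≥0) (ω : PathSpace N) => F (ω.1 s)) :=
    measurable_uncurry_of_continuousWithinAt_Ici
      (fun s => (measurable_of_countable F).comp (measurable_eval s))
      fun ω s => hF.continuousAt.comp_continuousWithinAt (ω.2 s).1
  exact hpath.comp (measurable_real_toNNReal.prodMap measurable_id)

end RightContinuity

section ReplacementEstimate

variable {N k : ℕ}

theorem occ_nonneg (η : Config N) (x : ZMod N) : 0 ≤ occ η x := Nat.cast_nonneg _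

theorem occ_le_one (η : Config N) (x : ZMod N) : occ η x ≤ 1 :=
  Nat.cast_le_one.2 (Nat.lt_succ_iff.1 (η x).2)

variable [NeZero N] {b : Fin k → UnitAddCircle} {β : ℝ}

theorem abs_occMatrix_mulVec_le (v : ZMod N → ℝ) (η : Config N) :
    |(occMatrix N *ᵥ v) η| ≤ ∑ y, |v y| := by
  refine (Finset.abs_sum_le_sum_abs _ _).trans (Finset.sum_le_sum fun y _ => ?_)
  rw [abs_mul]
  exact mul_le_of_le_one_left (abs_nonneg _)
    ((abs_of_nonneg (occ_nonneg η y)).trans_le (occ_le_one η y))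

theorem sum_abs_expIntegral_walkMatrix_le {c v : ZMod N → ℝ} {R : ℝ} (hR : 0 < R)
    (hv : ∀ g, (v ⬝ᵥ g) ^ 2 ≤ R * dirichletEnergy c g) {τ : ℝ} (hτ : 0 ≤ τ) :
    ∑ y, |expIntegral ((N : ℝ) ^ 2 • walkMatrix c) v τ y| ≤ √(R / (2 * N) * τ) := by
  have hN : (0 : ℝ) < N := Nat.cast_pos.2 (NeZero.pos N)
  refine (sum_abs_expIntegral_le (R := R / (N : ℝ) ^ 2) (by positivity)
    (fun g => ?_) hτ).trans_eq ?_
  · rw [smul_mulVec, dotProduct_smul, dotProduct_walkMatrix_mulVec, smul_eq_mul, mul_neg,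
      mul_neg, mul_neg, neg_neg, ← mul_assoc, div_mul_cancel₀ R (by positivity)]
    exact hv g
  · rw [ZMod.card]
    congr 1
    field_simp

theorem IsExclusionLaw.lintegral_abs_intervalIntegral_le {μ : Measure (Config N)}
    {P : Measure (PathSpace N)} (hP : IsExclusionLaw N b β μ P) {v : ZMod N → ℝ} {R : ℝ}
    (hR : 0 < R) (hv : ∀ g, (v ⬝ᵥ g) ^ 2 ≤ R * dirichletEnergy (conductance N b β) g)
    (hV : ∀ η, |(occMatrix N *ᵥ v) η| ≤ 1) {t : ℝ} (ht : 0 ≤ t) :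
    ∫⁻ ω, ENNReal.ofReal |∫ s in 0..t, (occMatrix N *ᵥ v) (ω.1 s.toNNReal)| ∂P ≤
      ENNReal.ofReal √(2 * (√(R / (2 * N) * t) * t)) := by
  have := hP.isProbabilityMeasure
  have hmeas := measurable_uncurry_comp_eval (occMatrix N *ᵥ v)
  have hbound := fun (s : ℝ) (ω : PathSpace N) => hV (ω.1 s.toNNReal)
  have hcorrelation : ∀ s ∈ Set.Icc 0 t, ∫ r in s..t, ∫ ω, (occMatrix N *ᵥ v) (ω.1 s.toNNReal) *
      (occMatrix N *ᵥ v) (ω.1 r.toNNReal) ∂P ≤ √(R / (2 * N) * t) := by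
    intro s hs
    have hdual : ((N : ℝ) ^ 2 • rateMatrix N b β) * occMatrix N =
        occMatrix N * ((N : ℝ) ^ 2 • walkMatrix (conductance N b β)) := by
      rw [Matrix.smul_mul, rateMatrix_mul_occMatrix, Matrix.mul_smul]
    have hresponse : ∀ η, |(occMatrix N *ᵥ expIntegral ((N : ℝ) ^ 2 •
        walkMatrix (conductance N b β)) v (t - s)) η| ≤ √(R / (2 * N) * t) := fun η =>
      (abs_occMatrix_mulVec_le _ η).trans <|
        (sum_abs_expIntegral_walkMatrix_le hR hv (sub_nonneg.2 hs.2)).trans <| by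
          gcongr
          exact sub_le_self t hs.1
    rw [hP.intervalIntegral_integral_mul_eval hs.1 hs.2, expIntegral_mulVec_of_mul_eq_mul hdual]
    have hproduct : ∀ η, ‖(occMatrix N *ᵥ v) η * (occMatrix N *ᵥ expIntegral ((N : ℝ) ^ 2 •
        walkMatrix (conductance N b β)) v (t - s)) η‖ ≤ √(R / (2 * N) * t) := fun η => by
      rw [norm_mul]
      exact (mul_le_of_le_one_left (norm_nonneg _) (hV η)).trans (hresponse η)
    have hmean := norm_integral_le_of_norm_le_const (μ := P)
      (.of_forall fun ω : PathSpace N => hproduct (ω.1 s.toNNReal))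
    rw [probReal_univ, mul_one] at hmean
    exact (le_abs_self _).trans hmean
  refine (lintegral_abs_le_sqrt_integral_sq (.of_bound
    (measurable_intervalIntegral hmeas 0 t).aestronglyMeasurable (1 * |t - 0|) (.of_forall fun ω =>
      intervalIntegral.norm_integral_le_of_norm_le_const fun s _ => hV _))).trans ?_
  gcongr
  simpa only [sub_zero] using integral_sq_intervalIntegral_le hmeas hbound ht hcorrelation

end ReplacementEstimate

section Resistance

variable {N : ℕ}

theorem injOn_add_natCast (w : ZMod N) : Set.InjOn (fun l : ℕ => w + (l : ZMod N)) (Set.Iio N) :=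
  fun _ hi _ hj hij => CharP.natCast_injOn_Iio (ZMod N) N hi hj (add_left_cancel hij)

theorem abs_sub_le_sum_range_abs (f : ℕ → ℝ) {ℓ i j : ℕ} (hi : i ≤ ℓ) (hj : j ≤ ℓ) :
    |f i - f j| ≤ ∑ l ∈ Finset.range ℓ, |f (l + 1) - f l| := by
  wlog hij : i ≤ j generalizing i j
  · rw [abs_sub_comm]
    exact this hj hi (le_of_not_ge hij)
  have hpath := dist_le_Ico_sum_dist f hij
  simp only [dist_comm (f _) (f (_ + 1)), Real.dist_eq] at hpath
  exact hpath.trans (Finset.sum_le_sum_of_subset_of_nonneg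
    (fun l hl => Finset.mem_range.2 ((Finset.mem_Ico.1 hl).2.trans_le hj))
    fun _ _ _ => abs_nonneg _)

theorem abs_sub_mean_le_sum_range_abs (f : ℕ → ℝ) {ℓ i : ℕ} (hℓ : 0 < ℓ) (hi : i ≤ ℓ) :
    |f i - 1 / (ℓ : ℝ) * ∑ j ∈ Finset.Icc 1 ℓ, f j| ≤
      ∑ l ∈ Finset.range ℓ, |f (l + 1) - f l| := by
  have hℓ' : (0 : ℝ) < ℓ := Nat.cast_pos.2 hℓ
  have hmean : f i - 1 / (ℓ : ℝ) * ∑ j ∈ Finset.Icc 1 ℓ, f j =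
      1 / (ℓ : ℝ) * ∑ j ∈ Finset.Icc 1 ℓ, (f i - f j) := by
    rw [Finset.sum_sub_distrib, Finset.sum_const, Nat.card_Icc, Nat.add_sub_cancel, nsmul_eq_mul]
    field_simp
  rw [hmean, abs_mul, abs_of_pos (one_div_pos.2 hℓ'), one_div_mul_eq_div, div_le_iff₀' hℓ']
  refine (Finset.abs_sum_le_sum_abs _ _).trans ((Finset.sum_le_card_nsmul _ _ _ fun j hj =>
    abs_sub_le_sum_range_abs f hi (Finset.mem_Icc.1 hj).2).trans_eq ?_)
  rw [Nat.card_Icc, Nat.add_sub_cancel, nsmul_eq_mul]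

/-- The resistance of the path of `ℓ` bonds which starts at `w`, where the bond `{x, x + 1}` has
conductance `c x`. -/
def pathResistance (c : ZMod N → ℝ) (w : ZMod N) (ℓ : ℕ) : ℝ :=
  ∑ l ∈ Finset.range ℓ, (c (w + l))⁻¹

/-- The coefficients of the linear functional `η(x) - boxMean ℓ η w`. -/
def boxCoeff (ℓ : ℕ) (x w : ZMod N) : ZMod N → ℝ :=
  Pi.single x 1 - (1 / (ℓ : ℝ)) • ∑ j ∈ Finset.Icc 1 ℓ, Pi.single (w + (j : ZMod N)) 1

theorem abs_occ_sub_boxMean_le_one (ℓ : ℕ) (η : Config N) (x w : ZMod N) :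
    |occ η x - boxMean ℓ η w| ≤ 1 := by
  have hnonneg : 0 ≤ boxMean ℓ η w :=
    mul_nonneg (by positivity) (Finset.sum_nonneg fun _ _ => occ_nonneg η _)
  have hle : boxMean ℓ η w ≤ 1 := by
    have hsum := Finset.sum_le_card_nsmul (Finset.Icc 1 ℓ) (fun j => occ η (w + (j : ZMod N))) 1
      fun _ _ => occ_le_one η _
    rw [Nat.card_Icc, Nat.add_sub_cancel, nsmul_one] at hsum
    rw [boxMean, one_div_mul_eq_div]
    exact div_le_one_of_le₀ hsum (Nat.cast_nonneg _)
  rw [abs_le]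
  constructor <;> linarith [occ_nonneg η x, occ_le_one η x]

variable [NeZero N]

theorem boxCoeff_dotProduct (ℓ : ℕ) (x w : ZMod N) (g : ZMod N → ℝ) :
    boxCoeff ℓ x w ⬝ᵥ g = g x - 1 / (ℓ : ℝ) * ∑ j ∈ Finset.Icc 1 ℓ, g (w + (j : ZMod N)) := by
  simp only [boxCoeff, sub_dotProduct, smul_dotProduct, sum_dotProduct, single_one_dotProduct,
    smul_eq_mul]

theorem occMatrix_mulVec_boxCoeff (ℓ : ℕ) (x w : ZMod N) (η : Config N) :
    (occMatrix N *ᵥ boxCoeff ℓ x w) η = occ η x - boxMean ℓ η w :=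
  (dotProduct_comm _ _).trans (boxCoeff_dotProduct ℓ x w (occ η))

theorem sq_sum_range_abs_le {c : ZMod N → ℝ} (hc : ∀ x, 0 < c x) (w : ZMod N) {ℓ : ℕ}
    (hℓN : ℓ ≤ N) (g : ZMod N → ℝ) :
    (∑ l ∈ Finset.range ℓ, |g (w + l + 1) - g (w + l)|) ^ 2 ≤
      pathResistance c w ℓ * dirichletEnergy c g := by
  have hinj : Set.InjOn (fun l : ℕ => w + (l : ZMod N)) (Finset.range ℓ) :=
    (injOn_add_natCast w).mono fun _ hl => (Finset.mem_range.1 hl).trans_le hℓN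
  calc (∑ l ∈ Finset.range ℓ, |g (w + l + 1) - g (w + l)|) ^ 2
      ≤ pathResistance c w ℓ *
          ∑ l ∈ Finset.range ℓ, c (w + l) * (g (w + l + 1) - g (w + l)) ^ 2 := by
        refine Finset.sum_sq_le_sum_mul_sum_of_sq_le_mul _ (fun l _ => (inv_pos.2 (hc _)).le)
          (fun l _ => mul_nonneg (hc _).le (sq_nonneg _)) fun l _ => ?_
        rw [sq_abs, inv_mul_cancel_left₀ (hc _).ne']
    _ ≤ pathResistance c w ℓ * dirichletEnergy c g := by
        refine mul_le_mul_of_nonneg_left ?_ (Finset.sum_nonneg fun _ _ => (inv_pos.2 (hc _)).le)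
        rw [← Finset.sum_image (f := fun x => c x * (g (x + 1) - g x) ^ 2) hinj]
        exact Finset.sum_le_sum_of_subset_of_nonneg (Finset.subset_univ _)
          fun x _ _ => mul_nonneg (hc x).le (sq_nonneg _)

theorem sq_boxCoeff_dotProduct_le {c : ZMod N → ℝ} (hc : ∀ x, 0 < c x) {ℓ i : ℕ} (hℓ : 0 < ℓ)
    (hℓN : ℓ ≤ N) (hi : i ≤ ℓ) (w : ZMod N) (g : ZMod N → ℝ) :
    (boxCoeff ℓ (w + (i : ZMod N)) w ⬝ᵥ g) ^ 2 ≤ pathResistance c w ℓ * dirichletEnergy c g := by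
  refine le_trans ?_ (sq_sum_range_abs_le hc w hℓN g)
  have hosc := abs_sub_mean_le_sum_range_abs (fun l : ℕ => g (w + l)) hℓ hi
  simp only [Nat.cast_add, Nat.cast_one, ← add_assoc] at hosc
  rw [boxCoeff_dotProduct, sq_le_sq]
  exact hosc.trans (le_abs_self _)

end Resistance

section SlowBonds

variable {N k : ℕ} {b : Fin k → UnitAddCircle} {β : ℝ}

theorem pathResistance_of_not_isSlowBond {w : ZMod N} {ℓ : ℕ}
    (h : ∀ l < ℓ, ¬ IsSlowBond N b (w + (l : ZMod N))) :
    pathResistance (conductance N b β) w ℓ = ℓ := by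
  have hunit : ∀ l ∈ Finset.range ℓ, (conductance N b β (w + l))⁻¹ = 1 := fun l hl => by
    rw [conductance, if_neg (h l (Finset.mem_range.1 hl)), inv_one]
  rw [pathResistance, Finset.sum_congr rfl hunit, Finset.sum_const, Finset.card_range, nsmul_one]

open Classical in
theorem inv_conductance_le (x : ZMod N) : (conductance N b β x)⁻¹ ≤
    1 + ∑ i, if IsLeftVertex N (b i) x then (N : ℝ) ^ β else 0 := by
  have hnonneg : ∀ i ∈ Finset.univ, 0 ≤ if IsLeftVertex N (b i) x then (N : ℝ) ^ β else 0 :=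
    fun i _ => by split_ifs <;> positivity
  unfold conductance
  split_ifs with hslow
  · obtain ⟨i, hi⟩ := hslow
    have hterm := Finset.single_le_sum hnonneg (Finset.mem_univ i)
    rw [if_pos hi] at hterm
    rw [Real.rpow_neg (Nat.cast_nonneg N), inv_inv]
    linarith
  · rw [inv_one]
    linarith [Finset.sum_nonneg hnonneg]

variable [NeZero N]

theorem IsLeftVertex.exists_eq {u : UnitAddCircle} {x : ZMod N} (h : IsLeftVertex N u x) :
    ∃ θ ∈ Set.Ioc (0 : ℝ) 1, u = ZMod.toAddCircle x + ((θ / N : ℝ) : UnitAddCircle) := by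
  have hN : (0 : ℝ) < N := Nat.cast_pos.2 (NeZero.pos N)
  obtain ⟨v, ⟨hlt, hle⟩, rfl⟩ := h
  rw [div_lt_iff₀ hN] at hlt
  rw [le_div_iff₀ hN] at hle
  refine ⟨v * N - x.val, ⟨by linarith, by linarith⟩, ?_⟩
  rw [ZMod.toAddCircle_apply, ← AddCircle.coe_add]
  congr 1
  field_simp
  ring

theorem IsLeftVertex.unique {u : UnitAddCircle} {x y : ZMod N} (hx : IsLeftVertex N u x)
    (hy : IsLeftVertex N u y) : x = y := by
  have hN : (0 : ℝ) < N := Nat.cast_pos.2 (NeZero.pos N)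
  have hIoc : ∀ (z : ZMod N), Set.Ioc ((z.val : ℝ) / N) ((z.val + 1) / N) ⊆ Set.Ioc 0 (0 + 1) := by
    intro z
    have hval : (z.val : ℝ) + 1 ≤ N := by exact_mod_cast ZMod.val_lt z
    exact Set.Ioc_subset_Ioc (by positivity) (by rwa [zero_add, div_le_one hN])
  obtain ⟨v, hv, rfl⟩ := hx
  obtain ⟨v', hv', hvv'⟩ := hy
  obtain rfl : v' = v := (AddCircle.coe_eq_coe_iff_of_mem_Ioc (hIoc y hv') (hIoc x hv)).1 hvv'
  obtain ⟨hxlt, hxle⟩ := hv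
  obtain ⟨hylt, hyle⟩ := hv'
  have hxy : (x.val : ℝ) < y.val + 1 := (div_lt_div_iff_of_pos_right hN).1 (hxlt.trans_le hyle)
  have hyx : (y.val : ℝ) < x.val + 1 := (div_lt_div_iff_of_pos_right hN).1 (hylt.trans_le hxle)
  norm_cast at hxy hyx
  exact ZMod.val_injective N (le_antisymm (Nat.lt_succ_iff.1 hxy) (Nat.lt_succ_iff.1 hyx))

theorem IsLeftVertex.dist_lt {u u' : UnitAddCircle} {w : ZMod N} {l ℓ : ℕ} (hl : l ≤ ℓ)
    (hu : IsLeftVertex N u (w + (l : ZMod N))) (hu' : IsLeftVertex N u' (w + (ℓ : ZMod N))) :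
    dist u u' < ((ℓ : ℝ) + 1) / N := by
  have hN : (0 : ℝ) < N := Nat.cast_pos.2 (NeZero.pos N)
  obtain ⟨θ, ⟨hθ_pos, hθ_le⟩, rfl⟩ := hu.exists_eq
  obtain ⟨θ', ⟨hθ'_pos, hθ'_le⟩, rfl⟩ := hu'.exists_eq
  have hl' : (l : ℝ) ≤ ℓ := Nat.cast_le.2 hl
  rw [map_add, map_add, ZMod.toAddCircle_natCast, ZMod.toAddCircle_natCast, add_assoc, add_assoc,
    dist_add_left, ← AddCircle.coe_add, ← AddCircle.coe_add, dist_eq_norm, ← AddCircle.coe_sub]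
  refine QuotientAddGroup.norm_mk_le_norm.trans_lt ?_
  rw [Real.norm_eq_abs, ← add_div, ← add_div, ← sub_div, abs_div, abs_of_pos hN]
  gcongr
  rw [abs_lt]
  constructor <;> linarith

theorem pathResistance_le (w : ZMod N) {ℓ : ℕ} (hℓN : ℓ ≤ N) :
    pathResistance (conductance N b β) w ℓ ≤ ℓ + k * (N : ℝ) ^ β := by
  classical
  have hpoint : ∀ i ∈ Finset.univ, ∑ l ∈ Finset.range ℓ,
      (if IsLeftVertex N (b i) (w + l) then (N : ℝ) ^ β else 0) ≤ (N : ℝ) ^ β := by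
    intro i _
    rw [← Finset.sum_filter, Finset.sum_const, nsmul_eq_mul]
    refine mul_le_of_le_one_left (by positivity) (Nat.cast_le_one.2 (Finset.card_le_one.2 ?_))
    intro l hl l' hl'
    rw [Finset.mem_filter, Finset.mem_range] at hl hl'
    exact injOn_add_natCast w (hl.1.trans_le hℓN) (hl'.1.trans_le hℓN) (hl.2.unique hl'.2)
  have hslow := Finset.sum_le_card_nsmul _ _ _ hpoint
  rw [Finset.card_univ, Fintype.card_fin, nsmul_eq_mul] at hslow
  calc pathResistance (conductance N b β) w ℓ
      ≤ ∑ l ∈ Finset.range ℓ,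
          (1 + ∑ i, if IsLeftVertex N (b i) (w + l) then (N : ℝ) ^ β else 0) :=
        Finset.sum_le_sum fun l _ => inv_conductance_le _
    _ ≤ ℓ + k * (N : ℝ) ^ β := by
        rw [Finset.sum_add_distrib, Finset.sum_comm, Finset.sum_const, Finset.card_range, nsmul_one]
        gcongr

theorem not_isSlowBond_of_lt {ℓ : ℕ}
    (hsep : ∀ i j, b i ≠ b j → ((ℓ : ℝ) + 1) / N ≤ dist (b i) (b j)) (hℓN : ℓ < N) {w : ZMod N}
    (hw : IsSlowBond N b (w + (ℓ : ZMod N))) {l : ℕ} (hl : l < ℓ) :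
    ¬ IsSlowBond N b (w + (l : ZMod N)) := by
  rintro ⟨i, hi⟩
  obtain ⟨j, hj⟩ := hw
  by_cases hij : b i = b j
  · rw [hij] at hi
    exact hl.ne (injOn_add_natCast w (hl.trans hℓN) hℓN (hi.unique hj))
  · exact (hsep i j hij).not_gt (hi.dist_lt hl.le hj)

theorem exists_empiricalDensity_eq_boxMean_of_one_le (hβ : 1 ≤ β) {ℓ : ℕ}
    (hsep : ∀ i j, b i ≠ b j → ((ℓ : ℝ) + 1) / N ≤ dist (b i) (b j)) (hℓN : ℓ < N) (x : ZMod N) :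
    ∃ (w : ZMod N) (i : ℕ), i ≤ ℓ ∧ x = w + i ∧ pathResistance (conductance N b β) w ℓ = ℓ ∧
      ∀ η, empiricalDensity b β ℓ η x = boxMean ℓ η w := by
  simp only [empiricalDensity, if_neg hβ.not_gt]
  split_ifs with hslow
  · set slow := {j : ℕ | IsSlowBond N b (x + (j : ZMod N))}
    obtain ⟨j, hj, hj_slow⟩ := hslow
    have hfirst_slow : IsSlowBond N b (x + (sInf slow : ℕ)) := Nat.sInf_mem (s := slow) ⟨j, hj_slow⟩
    have hfirst : sInf slow ≤ ℓ := (Nat.sInf_le (s := slow) hj_slow).trans hj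
    refine ⟨x + (sInf slow : ℕ) - ℓ, ℓ - sInf slow, Nat.sub_le _ _, ?_,
      pathResistance_of_not_isSlowBond fun l hl => ?_, fun _ => rfl⟩
    · rw [Nat.cast_sub hfirst]
      ring
    · exact not_isSlowBond_of_lt hsep hℓN (by rwa [sub_add_cancel]) hl
  · exact ⟨x, 0, zero_le, by rw [Nat.cast_zero, add_zero],
      pathResistance_of_not_isSlowBond fun l hl hl_slow => hslow ⟨l, hl.le, hl_slow⟩, fun _ => rfl⟩

end SlowBonds

section Replacement

variable {N k : ℕ} {b : Fin k → UnitAddCircle} {β ε t : ℝ}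

theorem abs_discrepancy_le_one (ω : PathSpace N) (s : ℝ) (x : ZMod N) :
    |discrepancy b β ε ω s x| ≤ 1 := by
  rw [discrepancy, empiricalDensity]
  split_ifs <;> exact abs_occ_sub_boxMean_le_one _ _ _ _

variable [NeZero N]

theorem IsExclusionLaw.lintegral_discrepancy_le {μ : Measure (Config N)}
    {P : Measure (PathSpace N)} (hP : IsExclusionLaw N b β μ P) (hε : 0 < ε) (ht : 0 ≤ t)
    (hℓ : 0 < ⌊ε * (N : ℝ)⌋₊) (hℓN : ⌊ε * (N : ℝ)⌋₊ ≤ N) {w : ZMod N} {i : ℕ}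
    (hi : i ≤ ⌊ε * (N : ℝ)⌋₊)
    (hR : pathResistance (conductance N b β) w ⌊ε * (N : ℝ)⌋₊ ≤ 2 * ε * N)
    (hbox : ∀ η : Config N, empiricalDensity b β ⌊ε * (N : ℝ)⌋₊ η (w + (i : ZMod N)) =
      boxMean ⌊ε * (N : ℝ)⌋₊ η w) :
    ∫⁻ ω, ENNReal.ofReal |∫ s in (0 : ℝ)..t, discrepancy b β ε ω s (w + (i : ZMod N))| ∂P ≤
      ENNReal.ofReal √(2 * (√(ε * t) * t)) := by
  have hN : (0 : ℝ) < N := Nat.cast_pos.2 (NeZero.pos N)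
  have hc := conductance_pos (N := N) b β
  have hdirichlet : ∀ g, (boxCoeff ⌊ε * (N : ℝ)⌋₊ (w + (i : ZMod N)) w ⬝ᵥ g) ^ 2 ≤
      2 * ε * N * dirichletEnergy (conductance N b β) g := fun g =>
    (sq_boxCoeff_dotProduct_le hc hℓ hℓN hi w g).trans <| mul_le_mul_of_nonneg_right hR <|
      Finset.sum_nonneg fun x _ => mul_nonneg (hc x).le (sq_nonneg _)
  have hestimate := hP.lintegral_abs_intervalIntegral_le (by positivity) hdirichlet
    (fun η => by
      rw [occMatrix_mulVec_boxCoeff]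
      exact abs_occ_sub_boxMean_le_one _ η _ _) ht
  have hεN : 2 * ε * N / (2 * N) = ε := by field_simp
  simpa only [discrepancy, hbox, ← occMatrix_mulVec_boxCoeff, hεN] using hestimate

theorem lintegral_sum_mul_discrepancy_le {P : Measure (PathSpace N)} (h : ZMod N → ℝ) {B : ℝ≥0∞}
    (hB : ∀ x : ZMod N,
      ∫⁻ ω, ENNReal.ofReal |∫ s in (0 : ℝ)..t, discrepancy b β ε ω s x| ∂P ≤ B) :
    ∫⁻ ω, ENNReal.ofReal |∫ s in (0 : ℝ)..t,
        (1 / (N : ℝ)) * ∑ x : ZMod N, h x * discrepancy b β ε ω s x| ∂P ≤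
      ENNReal.ofReal ((1 / (N : ℝ)) * ∑ x : ZMod N, |h x|) * B := by
  have hsum := lintegral_abs_intervalIntegral_sum_le (a := 0) (b := t)
    (Z := fun x s ω => discrepancy b β ε ω s x) (fun x =>
      measurable_uncurry_comp_eval fun η => occ η x - empiricalDensity b β ⌊ε * (N : ℝ)⌋₊ η x)
    (fun x s ω => abs_discrepancy_le_one ω s x) (fun x => 1 / (N : ℝ) * h x) hB
  simpa only [abs_mul, abs_of_nonneg (show 0 ≤ 1 / (N : ℝ) by positivity), mul_assoc,
    ← Finset.mul_sum] using hsum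

end Replacement

section Limits

variable {k : ℕ} (b : Fin k → UnitAddCircle)

theorem tendsto_pnat_cast_atTop : Tendsto (fun N : ℕ+ => (N : ℝ)) atTop atTop :=
  tendsto_natCast_atTop_atTop.comp tendsto_PNat_val_atTop_atTop

theorem eventually_mul_rpow_le_mul {β ε : ℝ} (hβ : β < 1) (hε : 0 < ε) (C : ℝ) :
    ∀ᶠ N : ℕ+ in atTop, C * (N : ℝ) ^ β ≤ ε * N := by
  have hlim := ((tendsto_rpow_neg_atTop (sub_pos.2 hβ)).comp tendsto_pnat_cast_atTop).const_mul C
  rw [mul_zero] at hlim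
  filter_upwards [hlim.eventually_le_const hε] with N hN
  have hpos : (0 : ℝ) < N := Nat.cast_pos.2 N.pos
  rwa [Function.comp_apply, neg_sub, Real.rpow_sub_one hpos.ne', ← mul_div_assoc,
    div_le_iff₀ hpos] at hN

theorem eventually_lt_dist_of_ne {ι α : Type*} [Finite ι] [MetricSpace α] (p : ι → α) :
    ∀ᶠ r : ℝ in 𝓝 0, ∀ i j, p i ≠ p j → r < dist (p i) (p j) := by
  refine eventually_all.2 fun i => eventually_all.2 fun j => ?_
  by_cases hij : p i = p j
  · exact .of_forall fun _ hne => absurd hij hne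
  · filter_upwards [Iio_mem_nhds (dist_pos.2 hij)] with r hr _ using hr

theorem exists_empiricalDensity_eq_boxMean {β ε : ℝ} {N : ℕ} [NeZero N] (hε : 0 < ε)
    (hsep : ∀ i j, b i ≠ b j → 2 * ε ≤ dist (b i) (b j)) (hεN : 1 ≤ ε * N)
    (hβ : β < 1 → k * (N : ℝ) ^ β ≤ ε * N) (hℓN : ⌊ε * (N : ℝ)⌋₊ < N) (x : ZMod N) :
    ∃ (w : ZMod N) (i : ℕ), i ≤ ⌊ε * (N : ℝ)⌋₊ ∧ x = w + i ∧
      pathResistance (conductance N b β) w ⌊ε * (N : ℝ)⌋₊ ≤ 2 * ε * N ∧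
      ∀ η, empiricalDensity b β ⌊ε * (N : ℝ)⌋₊ η x = boxMean ⌊ε * (N : ℝ)⌋₊ η w := by
  have hN : (0 : ℝ) < N := Nat.cast_pos.2 (NeZero.pos N)
  have hfloor : (⌊ε * (N : ℝ)⌋₊ : ℝ) ≤ ε * N := Nat.floor_le (by positivity)
  rcases lt_or_ge β 1 with hβ_lt | hβ_ge
  · refine ⟨x, 0, zero_le, by rw [Nat.cast_zero, add_zero], ?_, fun η => ?_⟩
    · exact (pathResistance_le x hℓN.le).trans (by linarith [hβ hβ_lt])
    · rw [empiricalDensity, if_pos hβ_lt]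
  · have hsep' : ∀ i j, b i ≠ b j → ((⌊ε * (N : ℝ)⌋₊ : ℝ) + 1) / N ≤ dist (b i) (b j) :=
      fun i j hij => ((div_le_iff₀ hN).2 (by linarith)).trans (hsep i j hij)
    obtain ⟨w, i, hi, hx, hR, hbox⟩ :=
      exists_empiricalDensity_eq_boxMean_of_one_le hβ_ge hsep' hℓN x
    exact ⟨w, i, hi, hx, by linarith, hbox⟩

theorem eventually_lintegral_discrepancy_le (β : ℝ) :
    ∀ᶠ ε : ℝ in 𝓝[>] 0, ∀ᶠ N : ℕ+ in atTop, ∀ (μ : Measure (Config N))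
      (P : Measure (PathSpace N)), IsExclusionLaw N b β μ P → ∀ t : ℝ, 0 ≤ t → ∀ x : ZMod N,
      ∫⁻ ω, ENNReal.ofReal |∫ s in (0 : ℝ)..t, discrepancy b β ε ω s x| ∂P ≤
        ENNReal.ofReal √(2 * (√(ε * t) * t)) := by
  have hdouble : Tendsto (fun ε : ℝ => 2 * ε) (𝓝[>] 0) (𝓝 0) :=
    tendsto_nhdsWithin_of_tendsto_nhds ((continuous_const_mul 2).tendsto' 0 0 (mul_zero 2))
  filter_upwards [hdouble.eventually (eventually_lt_dist_of_ne b), Ioo_mem_nhdsGT one_pos]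
    with ε hsep ⟨hε, hε_lt⟩
  have hslow : ∀ᶠ N : ℕ+ in atTop, β < 1 → k * (N : ℝ) ^ β ≤ ε * N :=
    eventually_imp_distrib_left.2 fun hβ => eventually_mul_rpow_le_mul hβ hε k
  filter_upwards [hslow, tendsto_pnat_cast_atTop.eventually_ge_atTop (1 / ε)]
    with N hN hεN μ P hP t ht x
  rw [div_le_iff₀' hε] at hεN
  have hpos : (0 : ℝ) < N := Nat.cast_pos.2 N.pos
  have hℓN : ⌊ε * (N : ℝ)⌋₊ < N :=
    (Nat.floor_lt (by positivity)).2 (mul_lt_of_lt_one_left hpos hε_lt)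
  obtain ⟨w, i, hi, rfl, hR, hbox⟩ :=
    exists_empiricalDensity_eq_boxMean b hε (fun i j h => (hsep i j h).le) hεN hN hℓN x
  exact hP.lintegral_discrepancy_le hε ht (Nat.floor_pos.2 hεN) hℓN.le hi hR hbox

theorem limsup_limsup_eq_zero {ι : Type*} {l : Filter ι} {F : ℝ → ι → ℝ≥0∞} {B : ℝ → ℝ≥0∞}
    (hB : Tendsto B (𝓝[>] 0) (𝓝 0)) (hF : ∀ᶠ ε in 𝓝[>] 0, ∀ᶠ N in l, F ε N ≤ B ε) :
    limsup (fun ε => limsup (F ε) l) (𝓝[>] 0) = 0 := by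
  refine le_antisymm (hB.limsup_eq ▸ limsup_le_limsup ?_) zero_le
  filter_upwards [hF] with ε hε
  exact limsup_le_of_le (h := hε)

theorem tendsto_const_mul_ofReal_sqrt {C : ℝ≥0∞} (hC : C ≠ ⊤) (t : ℝ) :
    Tendsto (fun ε : ℝ => C * ENNReal.ofReal √(2 * (√(ε * t) * t))) (𝓝[>] 0) (𝓝 0) := by
  have hcont : Continuous fun ε : ℝ => √(2 * (√(ε * t) * t)) := by fun_prop
  simpa using ENNReal.Tendsto.const_mul (a := C) (ENNReal.tendsto_ofReal
    ((hcont.tendsto 0).mono_left (nhdsWithin_le_nhds (s := Set.Ioi 0)))) (.inr hC)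

theorem limsup_mean_abs_lt_top {h : ∀ N : ℕ+, ZMod N → ℝ}
    (hh : limsup (fun N : ℕ+ => ENNReal.ofReal ((1 / (N : ℝ)) * ∑ x, h N x ^ 2)) atTop < ⊤) :
    limsup (fun N : ℕ+ => ENNReal.ofReal ((1 / (N : ℝ)) * ∑ x, |h N x|)) atTop < ⊤ := by
  obtain ⟨C, hC, hC_top⟩ := exists_between hh
  refine lt_of_le_of_lt (limsup_le_of_le (h := ?_))
    (ENNReal.add_lt_top.2 ⟨ENNReal.one_lt_top, hC_top⟩)
  filter_upwards [eventually_lt_of_limsup_lt hC] with N hN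
  have hN_pos : (0 : ℝ) < N := Nat.cast_pos.2 N.pos
  calc ENNReal.ofReal ((1 / (N : ℝ)) * ∑ x, |h N x|)
      ≤ ENNReal.ofReal ((1 / (N : ℝ)) * ∑ x, (1 + h N x ^ 2)) := by
        gcongr with x
        nlinarith [sq_nonneg (|h N x| - 1), sq_abs (h N x)]
    _ = 1 + ENNReal.ofReal ((1 / (N : ℝ)) * ∑ x, h N x ^ 2) := by
        rw [Finset.sum_add_distrib, Finset.sum_const, Finset.card_univ, ZMod.card, nsmul_one,
          mul_add, one_div_mul_cancel hN_pos.ne', ENNReal.ofReal_add zero_le_one (by positivity),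
          ENNReal.ofReal_one]
    _ ≤ 1 + C := by gcongr

end Limits

end SlowBond

end

theorem mainTheorem2_general {k : ℕ} (b : Fin k → UnitAddCircle) (β : ℝ)
    (μ : ∀ N : ℕ+, Measure (SlowBond.Config N)) (P : ∀ N : ℕ+, Measure (SlowBond.PathSpace N))
    (hP : ∀ N : ℕ+, SlowBond.IsExclusionLaw N b β (μ N) (P N)) (t : ℝ) (ht : 0 ≤ t) :
    (∀ x : ∀ N : ℕ+, ZMod N,
      limsup (fun ε : ℝ => limsup (fun N : ℕ+ =>
        ∫⁻ ω, ENNReal.ofReal |∫ s in (0 : ℝ)..t, SlowBond.discrepancy b β ε ω s (x N)| ∂(P N))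
        atTop) (𝓝[>] 0) = 0) ∧
    (∀ h : ∀ N : ℕ+, ZMod N → ℝ,
      limsup (fun N : ℕ+ => ENNReal.ofReal ((1 / (N : ℝ)) * ∑ x, |h N x|)) atTop < ⊤ →
      limsup (fun ε : ℝ => limsup (fun N : ℕ+ =>
        ∫⁻ ω, ENNReal.ofReal |∫ s in (0 : ℝ)..t,
          (1 / (N : ℝ)) * ∑ x : ZMod N, h N x * SlowBond.discrepancy b β ε ω s x| ∂(P N))
        atTop) (𝓝[>] 0) = 0) := by
  have hsites := SlowBond.eventually_lintegral_discrepancy_le b β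
  refine ⟨fun x => ?_, fun h hh => ?_⟩
  · refine SlowBond.limsup_limsup_eq_zero
      (SlowBond.tendsto_const_mul_ofReal_sqrt ENNReal.one_ne_top t) ?_
    filter_upwards [hsites] with ε hε
    filter_upwards [hε] with N hN
    exact (hN (μ N) (P N) (hP N) t ht (x N)).trans_eq (one_mul _).symm
  · obtain ⟨C, hC, hC_top⟩ := exists_between hh
    refine SlowBond.limsup_limsup_eq_zero
      (SlowBond.tendsto_const_mul_ofReal_sqrt hC_top.ne t) ?_
    filter_upwards [hsites] with ε hε
    filter_upwards [hε, eventually_lt_of_limsup_lt hC] with N hN hN_lt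
    exact (SlowBond.lintegral_sum_mul_discrepancy_le (h N)
      (hN (μ N) (P N) (hP N) t ht)).trans (mul_le_mul_left hN_lt.le _)

theorem mainTheorem2 {k : ℕ} (b : Fin k → UnitAddCircle) (β : ℝ) (hβ : 0 ≤ β)
    (μ : ∀ N : ℕ+, Measure (SlowBond.Config N)) (hμ : ∀ N, IsProbabilityMeasure (μ N))
    (P : ∀ N : ℕ+, Measure (SlowBond.PathSpace N))
    (hP : ∀ N : ℕ+, SlowBond.IsExclusionLaw N b β (μ N) (P N))
    (t : ℝ) (ht : 0 ≤ t) :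
    (β < 1 → ∀ (u : UnitAddCircle) (x : ∀ N : ℕ+, ZMod N),
      (∀ N : ℕ+, SlowBond.IsLeftVertex N u (x N) ∨ SlowBond.IsLeftVertex N u (x N - 1)) →
      limsup (fun ε : ℝ => limsup (fun N : ℕ+ =>
        ∫⁻ ω, ENNReal.ofReal |∫ s in (0 : ℝ)..t, SlowBond.discrepancy b β ε ω s (x N)| ∂(P N))
        atTop) (𝓝[>] 0) = 0) ∧
    (1 ≤ β →
      (∀ x : ∀ N : ℕ+, ZMod N,
        limsup (fun ε : ℝ => limsup (fun N : ℕ+ =>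
          ∫⁻ ω, ENNReal.ofReal |∫ s in (0 : ℝ)..t, SlowBond.discrepancy b β ε ω s (x N)| ∂(P N))
          atTop) (𝓝[>] 0) = 0) ∧
      (∀ H : UnitAddCircle → ℝ,
        limsup (fun N : ℕ+ => ENNReal.ofReal
          ((1 / (N : ℝ)) * ∑ x : ZMod N, (H (SlowBond.macro_point N x)) ^ 2)) atTop < ⊤ →
        limsup (fun ε : ℝ => limsup (fun N : ℕ+ =>
          ∫⁻ ω, ENNReal.ofReal |∫ s in (0 : ℝ)..t,
            (1 / (N : ℝ)) * ∑ x : ZMod N, H (SlowBond.macro_point N x) *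
              SlowBond.discrepancy b β ε ω s x| ∂(P N))
          atTop) (𝓝[>] 0) = 0)) := by
  obtain ⟨hsite, hweighted⟩ := mainTheorem2_general b β μ P hP t ht
  exact ⟨fun _ _ x _ => hsite x, fun _ => ⟨hsite, fun H hH =>
    hweighted (fun N x => H (SlowBond.macro_point N x)) (SlowBond.limsup_mean_abs_lt_top hH)⟩⟩
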